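/- Let $X$ and $Y$ be topological spaces. A set $A\subseteq X$ is functionally closed if $A=\varphi^{-1}(0)$ for some continuous $\varphi:X\to[0,1]$, and functionally open if its complement is functionally closed; $A$ is an $F_\sigma$-set (a functionally $F_\sigma$-set) if it is the union of a sequence of closed (functionally closed) subsets of $X$. For an arbitrary map $f:X\to Y$ write - $f\in \mathrm H_1(X,Y)$ if $f^{-1}(V)$ is an $F_\sigma$-set in $X$ for every open $V\subseteq Y$; - $f\in \mathrm K_1(X,Y)$ if $f^{-1}(V)$ is a functionally $F_\sigma$-set in $X$ for every open $V\subseteq Y$; - $f\in \mathrm K_1^w(X,Y)$ if $f^{-1}(V)$ is a functionally $F_\sigma$-set in $X$ for every functionally open $V\subseteq Y$. Let $\upsilon X$ be the Hewitt realcompactification of $X$, i.e. the closure of the image of $X$ under the evaluation map $x\mapsto (g(x))_{g\in C(X,\mathbb R)}$ in the product $\mathbb R^{C(X,\mathbb R)}$. A space is normal if any two disjoint closed subsets have disjoint open neighbourhoods, and perfectly normal if it is normal and every closed subset is a $G_\delta$-set (points need not be closed in either case). Then: 1. $\mathrm K_1(X,Y)\subseteq \mathrm K_1^w(X,Y)$;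 2. $\mathrm K_1(X,Y)=\mathrm H_1(X,Y)$ if $X$ is perfectly normal; 3. $\mathrm K_1(X,Y)=\mathrm K_1^w(X,Y)\subseteq \mathrm H_1(X,Y)$ if $Y$ is perfectly normal; 4. $\mathrm H_1(X,Y)\subseteq \mathrm K_1^w(X,Y)$ if $X$ is normal; 5. $\mathrm H_1(\upsilon X,Y)\subseteq \mathrm K_1^w(\upsilon X,Y)$ if $X$ is normal. -/

import Mathlib

open Set Topology

universe u v

section Sets

variable {X : Type u} [TopologicalSpace X]

/-- A functionally closed set (zero set): `φ ⁻¹(0)` for some continuous `φ : X → [0,1]`. -/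
def IsFunctionallyClosed (A : Set X) : Prop :=
  ∃ φ : C(X, unitInterval), A = φ ⁻¹' {0}

/-- A functionally open set (cozero set): the complement of a functionally closed set. -/
def IsFunctionallyOpen (A : Set X) : Prop :=
  IsFunctionallyClosed Aᶜ

/-- An `F_σ`-set: the union of a sequence of closed sets. -/
def IsFSigma (A : Set X) : Prop :=
  ∃ F : ℕ → Set X, (∀ n, IsClosed (F n)) ∧ A = ⋃ n, F n

/-- A functionally `F_σ`-set: the union of a sequence of functionally closed sets. -/
def IsFunctionallyFSigma (A : Set X) : Prop :=
  ∃ F : ℕ → Set X, (∀ n, IsFunctionallyClosed (F n)) ∧ A = ⋃ n, F n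

end Sets

section Classes

variable (X : Type u) (Y : Type v) [TopologicalSpace X] [TopologicalSpace Y]

/-- The first Lebesgue class `H₁(X,Y)`. -/
def LebesgueH1 : Set (X → Y) :=
  {f | ∀ V : Set Y, IsOpen V → IsFSigma (f ⁻¹' V)}

/-- The first functional Lebesgue class `K₁(X,Y)`. -/
def LebesgueK1 : Set (X → Y) :=
  {f | ∀ V : Set Y, IsOpen V → IsFunctionallyFSigma (f ⁻¹' V)}

/-- The first weak functional Lebesgue class `K₁ʷ(X,Y)`. -/
def LebesgueK1w : Set (X → Y) :=
  {f | ∀ V : Set Y, IsFunctionallyOpen V → IsFunctionallyFSigma (f ⁻¹' V)}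

end Classes

section Hewitt

variable (X : Type u) [TopologicalSpace X]

/-- The Hewitt realcompactification `υX`: the closure, in the product `ℝ^{C(X)}`, of the image of
`X` under the evaluation map `x ↦ (g x)_{g ∈ C(X)}`, with the subspace topology. -/
def HewittRealcompactification : Type u :=
  closure (range fun (x : X) (g : C(X, ℝ)) => g x)

instance : TopologicalSpace (HewittRealcompactification X) :=
  inferInstanceAs (TopologicalSpace (closure (range fun (x : X) (g : C(X, ℝ)) => g x)))

namespace HewittRealcompactification

/-- The canonical map `X → υX`. -/
def of (x : X) : HewittRealcompactification X :=
  ⟨fun g => g x, subset_closure (mem_range_self x)⟩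

theorem continuous_of : Continuous (of X) :=
  Continuous.subtype_mk (continuous_pi fun g => g.continuous) _

/-- `X` is dense in `υX`. -/
theorem denseRange_of : DenseRange (of X) := by
  intro z
  refine IsInducing.subtypeVal.closure_eq_preimage_closure_image (range (of X)) ▸ ?_
  refine closure_mono ?_ z.2
  rintro _ ⟨x, rfl⟩
  exact ⟨of X x, mem_range_self x, rfl⟩

/-- `X` is `C`-embedded in `υX`: continuous real functions on `X` extend to `υX`. -/
theorem exists_extension (g : C(X, ℝ)) :
    ∃ G : C(HewittRealcompactification X, ℝ), ∀ x, G (of X x) = g x :=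
  ⟨⟨fun z => z.1 g, (continuous_apply g).comp continuous_subtype_val⟩, fun _ => rfl⟩

/-- For completely regular Hausdorff `X` the canonical map is a topological embedding. -/
theorem isEmbedding_of [T35Space X] : IsEmbedding (of X) := by
  have hX : IsInducing (of X) := by
    refine isInducing_iff_nhds.2 fun x => le_antisymm
      ((continuous_of X).tendsto x).le_comap fun s hs => ?_
    obtain ⟨U, hUs, hU, hxU⟩ := mem_nhds_iff.1 hs
    obtain ⟨f, hf, hfx, hfU⟩ :=
      CompletelyRegularSpace.completely_regular x Uᶜ hU.isClosed_compl (by simpa using hxU)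
    obtain ⟨G, hG⟩ := exists_extension X ⟨fun y => (f y : ℝ), by fun_prop⟩
    refine ⟨G ⁻¹' Iio 1, (isOpen_Iio.preimage G.continuous).mem_nhds ?_, fun y hy => hUs ?_⟩
    · simp [hG, hfx]
    · by_contra hyU
      have h1 : f y = 1 := hfU hyU
      simp [hG, h1] at hy
  exact hX.isEmbedding

end HewittRealcompactification

end Hewitt

section Sets

variable {X : Type u} [TopologicalSpace X]

/-! In a perfectly normal space closed sets are zero sets, which settles the claims about such
spaces. For normal `X`, exhaust a cozero `V` by open `U n` inside closed `Z n ⊆ V`. The `F_σ`-set `f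
⁻¹' U n` lies in the `Gδ`-set `f ⁻¹' Z n`, Urysohn's lemma inserts a functionally `F_σ`-set between
them, and the union of these is `f ⁻¹' V`. For `υX`, apply this to the restriction of `f` to `X` and
extend the zero sets obtained to `υX`. The resulting set agrees with `f ⁻¹' V` on `X`, hence
everywhere, because every nonempty `Gδ`-set of `υX` meets `X`. -/

theorem isFunctionallyClosed_of_real (g : C(X, ℝ)) : IsFunctionallyClosed {x | g x = 0} := by
  refine ⟨⟨fun x => projIcc (0 : ℝ) 1 zero_le_one |g x|,
    continuous_projIcc.comp (g.continuous.abs)⟩, ?_⟩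
  ext x
  simp only [mem_ofPred_eq, mem_preimage, ContinuousMap.coe_mk, mem_singleton_iff]
  change _ ↔ projIcc (0 : ℝ) 1 zero_le_one |g x| = ⟨0, left_mem_Icc.2 zero_le_one⟩
  rw [projIcc_eq_left zero_lt_one, abs_nonpos_iff]

theorem isFunctionallyClosed_iff_real {A : Set X} :
    IsFunctionallyClosed A ↔ ∃ g : C(X, ℝ), A = {x | g x = 0} := by
  constructor
  · rintro ⟨φ, rfl⟩
    refine ⟨⟨fun x => (φ x : ℝ), by fun_prop⟩, ?_⟩
    ext x
    simp
  · rintro ⟨g, rfl⟩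
    exact isFunctionallyClosed_of_real g

theorem IsFunctionallyClosed.isClosed {A : Set X} (h : IsFunctionallyClosed A) : IsClosed A := by
  obtain ⟨φ, rfl⟩ := h
  exact isClosed_singleton.preimage φ.continuous

theorem IsFunctionallyOpen.isOpen {A : Set X} (h : IsFunctionallyOpen A) : IsOpen A :=
  isClosed_compl_iff.1 (IsFunctionallyClosed.isClosed h)

theorem IsFunctionallyFSigma.isFSigma {A : Set X} (h : IsFunctionallyFSigma A) : IsFSigma A := by
  obtain ⟨F, hF, rfl⟩ := h
  exact ⟨F, fun n => (hF n).isClosed, rfl⟩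

theorem IsFSigma.isGδ_compl {A : Set X} (h : IsFSigma A) : IsGδ Aᶜ := by
  obtain ⟨F, hF, rfl⟩ := h
  rw [compl_iUnion]
  exact IsGδ.iInter_of_isOpen fun n => (hF n).isOpen_compl

theorem IsFunctionallyClosed.isGδ {A : Set X} (h : IsFunctionallyClosed A) : IsGδ A := by
  obtain ⟨φ, rfl⟩ := h
  exact (IsGδ.singleton 0).preimage φ.continuous

/-- A geometrically weighted sum of nonnegative functions vanishes exactly where all of them do. -/
theorem isFunctionallyClosed_iInter {A : ℕ → Set X} (h : ∀ n, IsFunctionallyClosed (A n)) :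
    IsFunctionallyClosed (⋂ n, A n) := by
  choose φ hφ using h
  have hle (n : ℕ) (x : X) : (1 / 2 : ℝ) ^ n * (φ n x : ℝ) ≤ (1 / 2 : ℝ) ^ n :=
    mul_le_of_le_one_right (by positivity) (φ n x).2.2
  have hnn (n : ℕ) (x : X) : 0 ≤ (1 / 2 : ℝ) ^ n * (φ n x : ℝ) :=
    mul_nonneg (by positivity) (φ n x).2.1
  have hsum (x : X) : Summable fun n => (1 / 2 : ℝ) ^ n * (φ n x : ℝ) :=
    Summable.of_nonneg_of_le (fun n => hnn n x) (fun n => hle n x) summable_geometric_two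
  have hcont : Continuous fun x => ∑' n, (1 / 2 : ℝ) ^ n * (φ n x : ℝ) := by
    refine continuous_tsum (fun n => by fun_prop) summable_geometric_two fun n x => ?_
    rw [Real.norm_of_nonneg (hnn n x)]
    exact hle n x
  refine isFunctionallyClosed_iff_real.2 ⟨⟨_, hcont⟩, ?_⟩
  ext x
  have key : (∑' n, (1 / 2 : ℝ) ^ n * (φ n x : ℝ)) = 0 ↔ ∀ n, φ n x = 0 := by
    rw [← (hsum x).hasSum_iff, hasSum_zero_iff_of_nonneg fun n => hnn n x]
    simp [funext_iff]
  rw [mem_iInter]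
  simp only [hφ, mem_preimage, mem_singleton_iff]
  exact key.symm

theorem IsFunctionallyFSigma.iUnion {A : ℕ → Set X} (h : ∀ n, IsFunctionallyFSigma (A n)) :
    IsFunctionallyFSigma (⋃ n, A n) := by
  choose F hF hA using h
  refine ⟨fun k => F k.unpair.1 k.unpair.2, fun k => hF _ _, ?_⟩
  rw [Set.iUnion_unpair F]
  exact iUnion_congr hA

/-- Intersect the Urysohn zero sets obtained for the countably many open sets defining `G`. -/
theorem IsClosed.exists_isFunctionallyClosed_between [NormalSpace X] {F G : Set X}
    (hF : IsClosed F) (hG : IsGδ G) (hFG : F ⊆ G) :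
    ∃ Z, IsFunctionallyClosed Z ∧ F ⊆ Z ∧ Z ⊆ G := by
  obtain ⟨U, hU, rfl⟩ := isGδ_iff_eq_iInter_nat.1 hG
  have (n : ℕ) : ∃ Z, IsFunctionallyClosed Z ∧ F ⊆ Z ∧ Z ⊆ U n := by
    obtain ⟨g, hg0, hg1, -⟩ := exists_continuous_zero_one_of_isClosed hF (hU n).isClosed_compl
      (disjoint_compl_right_iff_subset.2 (hFG.trans (iInter_subset U n)))
    refine ⟨{x | g x = 0}, isFunctionallyClosed_of_real g, fun x hx => hg0 hx, fun x hx => ?_⟩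
    by_contra hxU
    have h1 : g x = 1 := hg1 hxU
    exact zero_ne_one (Eq.trans (Eq.symm hx) h1)
  choose Z hZ hFZ hZU using this
  exact ⟨⋂ n, Z n, isFunctionallyClosed_iInter hZ, subset_iInter hFZ, iInter_mono hZU⟩

theorem IsClosed.isFunctionallyClosed [PerfectlyNormalSpace X] {A : Set X} (hA : IsClosed A) :
    IsFunctionallyClosed A := by
  obtain ⟨Z, hZ, h1, h2⟩ :=
    hA.exists_isFunctionallyClosed_between (PerfectlyNormalSpace.closed_gdelta hA) subset_rfl
  rwa [h1.antisymm h2]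

theorem IsFSigma.exists_isFunctionallyFSigma_between [NormalSpace X] {A G : Set X}
    (hA : IsFSigma A) (hG : IsGδ G) (hAG : A ⊆ G) :
    ∃ B, IsFunctionallyFSigma B ∧ A ⊆ B ∧ B ⊆ G := by
  obtain ⟨F, hF, rfl⟩ := hA
  choose Z hZ hFZ hZG using fun n =>
    (hF n).exists_isFunctionallyClosed_between hG ((subset_iUnion F n).trans hAG)
  exact ⟨⋃ n, Z n, ⟨Z, hZ, rfl⟩, iUnion_mono hFZ, iUnion_subset hZG⟩

/-- A cozero set is exhausted by open sets `V n`, each contained in a closed subset `Z n`. -/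
theorem IsFunctionallyOpen.exists_exhaustion {V : Set X} (hV : IsFunctionallyOpen V) :
    ∃ U Z : ℕ → Set X, (∀ n, IsOpen (U n)) ∧ (∀ n, IsClosed (Z n)) ∧ (∀ n, U n ⊆ Z n) ∧
      (∀ n, Z n ⊆ V) ∧ V = ⋃ n, U n := by
  obtain ⟨φ, hφ⟩ := hV
  have hmem (x : X) : x ∈ V ↔ 0 < (φ x : ℝ) := by
    rw [← notMem_compl_iff, hφ, mem_preimage, mem_singleton_iff, ← ne_eq,
      ← unitInterval.pos_iff_ne_zero]
    rfl
  have hc : Continuous fun x => (φ x : ℝ) := by fun_prop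
  refine ⟨fun n => {x | 1 / ((n : ℝ) + 1) < φ x}, fun n => {x | 1 / ((n : ℝ) + 1) ≤ φ x},
    fun n => isOpen_lt continuous_const hc, fun n => isClosed_le continuous_const hc,
    fun n x hx => (mem_ofPred_eq ▸ hx : _ < _).le, fun n x hx => ?_, ?_⟩
  · exact (hmem x).2 (Nat.one_div_pos_of_nat.trans_le hx)
  · ext x
    rw [hmem, mem_iUnion]
    exact ⟨exists_nat_one_div_lt, fun ⟨n, hn⟩ => Nat.one_div_pos_of_nat.trans hn⟩

end Sets

section Classes

variable {X : Type u} {Y : Type v} [TopologicalSpace X] [TopologicalSpace Y]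

theorem LebesgueH1.isGδ_preimage {f : X → Y} (hf : f ∈ LebesgueH1 X Y) {Z : Set Y}
    (hZ : IsClosed Z) : IsGδ (f ⁻¹' Z) := by
  simpa [preimage_compl] using (hf Zᶜ hZ.isOpen_compl).isGδ_compl

theorem LebesgueH1.comp_continuous {W : Type*} [TopologicalSpace W] {f : X → Y}
    (hf : f ∈ LebesgueH1 X Y) {e : W → X} (he : Continuous e) : f ∘ e ∈ LebesgueH1 W Y := by
  intro V hV
  obtain ⟨F, hF, hFV⟩ := hf V hV
  exact ⟨fun n => e ⁻¹' F n, fun n => (hF n).preimage he, by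
    rw [preimage_comp, hFV, preimage_iUnion]⟩

theorem lebesgueH1_subset_lebesgueK1w [NormalSpace X] : LebesgueH1 X Y ⊆ LebesgueK1w X Y := by
  intro f hf V hV
  obtain ⟨U, Z, hU, hZ, hUZ, hZV, hVU⟩ := hV.exists_exhaustion
  choose B hB hUB hBZ using fun n => (hf (U n) (hU n)).exists_isFunctionallyFSigma_between
    (LebesgueH1.isGδ_preimage hf (hZ n)) (preimage_mono (hUZ n))
  have : f ⁻¹' V = ⋃ n, B n := by
    refine Subset.antisymm ?_ (iUnion_subset fun n => (hBZ n).trans (preimage_mono (hZV n)))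
    rw [hVU, preimage_iUnion]
    exact iUnion_mono hUB
  rw [this]
  exact IsFunctionallyFSigma.iUnion hB

end Classes

namespace HewittRealcompactification

variable {X : Type u} [TopologicalSpace X]

instance : T35Space (HewittRealcompactification X) :=
  inferInstanceAs (T35Space (closure (range fun (x : X) (g : C(X, ℝ)) => g x)))

/-- A nonempty zero set of `υX` meets `X`. -/
theorem exists_of_mem_of_isFunctionallyClosed {Z : Set (HewittRealcompactification X)}
    (hZ : IsFunctionallyClosed Z) (hne : Z.Nonempty) : ∃ x, of X x ∈ Z := by
  obtain ⟨g, rfl⟩ := isFunctionallyClosed_iff_real.1 hZ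
  obtain ⟨p, hp⟩ := hne
  by_contra! h
  -- If `g` has no zero on `X`, its reciprocal there extends to `G`, and `G * g = 1` on all of `υX`
  -- by density, even at the zero `p`.
  obtain ⟨G, hG⟩ := exists_extension X
    ⟨fun x => (g (of X x))⁻¹, (g.continuous.comp (continuous_of X)).inv₀ h⟩
  have key : (fun z => G z * g z) = fun _ => (1 : ℝ) :=
    (denseRange_of X).equalizer (by fun_prop) continuous_const <| by
      ext x
      simpa [hG] using inv_mul_cancel₀ (h x)
  have hp1 := congrFun key p
  have hp0 : g p = 0 := hp
  simp [hp0] at hp1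

/-- A nonempty `Gδ`-set of `υX` meets `X`. -/
theorem exists_of_mem_of_isGδ {A : Set (HewittRealcompactification X)}
    (hA : IsGδ A) (hne : A.Nonempty) : ∃ x, of X x ∈ A := by
  obtain ⟨U, hU, rfl⟩ := isGδ_iff_eq_iInter_nat.1 hA
  obtain ⟨p, hp⟩ := hne
  have (n : ℕ) : ∃ Z, IsFunctionallyClosed Z ∧ p ∈ Z ∧ Z ⊆ U n := by
    obtain ⟨φ, hφ, hφ0, hφ1⟩ := CompletelyRegularSpace.completely_regular p (U n)ᶜ
      (hU n).isClosed_compl (by simpa using mem_iInter.1 hp n)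
    refine ⟨φ ⁻¹' {0}, ⟨⟨φ, hφ⟩, rfl⟩, hφ0, fun z hz => ?_⟩
    by_contra hzU
    exact zero_ne_one (Eq.trans (Eq.symm hz) (hφ1 hzU))
  choose Z hZ hpZ hZU using this
  obtain ⟨x, hx⟩ := exists_of_mem_of_isFunctionallyClosed (isFunctionallyClosed_iInter hZ)
    ⟨p, mem_iInter.2 hpZ⟩
  exact ⟨x, iInter_mono hZU hx⟩

theorem exists_isFunctionallyClosed_preimage_of {Z : Set X} (hZ : IsFunctionallyClosed Z) :
    ∃ Z', IsFunctionallyClosed Z' ∧ of X ⁻¹' Z' = Z := by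
  obtain ⟨g, rfl⟩ := isFunctionallyClosed_iff_real.1 hZ
  obtain ⟨G, hG⟩ := exists_extension X g
  exact ⟨_, isFunctionallyClosed_of_real G, by simp [hG]⟩

theorem exists_isFunctionallyFSigma_preimage_of {A : Set X} (hA : IsFunctionallyFSigma A) :
    ∃ A', IsFunctionallyFSigma A' ∧ of X ⁻¹' A' = A := by
  obtain ⟨F, hF, rfl⟩ := hA
  choose F' hF' hFF' using fun n => exists_isFunctionallyClosed_preimage_of (hF n)
  exact ⟨⋃ n, F' n, ⟨F', hF', rfl⟩, by rw [preimage_iUnion]; exact iUnion_congr hFF'⟩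

theorem lebesgueH1_subset_lebesgueK1w {Y : Type v} [TopologicalSpace Y] [NormalSpace X] :
    LebesgueH1 (HewittRealcompactification X) Y ⊆
      LebesgueK1w (HewittRealcompactification X) Y := by
  intro f hf V hV
  obtain ⟨A, hA, hAV⟩ := exists_isFunctionallyFSigma_preimage_of
    (_root_.lebesgueH1_subset_lebesgueK1w
      (LebesgueH1.comp_continuous hf (continuous_of X)) V hV)
  have hmem (x : X) : of X x ∈ A ↔ of X x ∈ f ⁻¹' V := Set.ext_iff.1 hAV x
  suffices f ⁻¹' V = A by rwa [this]
  obtain ⟨U, Z, -, hZ, hUZ, hZV, hVU⟩ := hV.exists_exhaustion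
  refine Subset.antisymm (fun p hp => ?_) (fun p hp => ?_)
  -- `f ⁻¹' V` need not be `Gδ`, so the closed `Z n` between `U n` and `V` supplies a `Gδ`-set
  -- through `p`.
  · by_contra hpA
    rw [hVU, preimage_iUnion] at hp
    obtain ⟨n, hn⟩ := mem_iUnion.1 hp
    obtain ⟨x, hxZ, hxA⟩ := exists_of_mem_of_isGδ
      ((LebesgueH1.isGδ_preimage hf (hZ n)).inter hA.isFSigma.isGδ_compl) ⟨p, hUZ n hn, hpA⟩
    exact hxA ((hmem x).2 (hZV n hxZ))
  -- Here the zero set `F n`, being `Gδ`, plays that role.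
  · by_contra hpV
    obtain ⟨F, hF, rfl⟩ := hA
    obtain ⟨n, hn⟩ := mem_iUnion.1 hp
    obtain ⟨x, hxF, hxV⟩ := exists_of_mem_of_isGδ
      ((hF n).isGδ.inter (hf V hV.isOpen).isGδ_compl) ⟨p, hn, hpV⟩
    exact hxV ((hmem x).1 (mem_iUnion_of_mem n hxF))

end HewittRealcompactification

theorem mainTheorem7 (X : Type u) (Y : Type v) [TopologicalSpace X] [TopologicalSpace Y] :
    LebesgueK1 X Y ⊆ LebesgueK1w X Y ∧
    (PerfectlyNormalSpace X → LebesgueK1 X Y = LebesgueH1 X Y) ∧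
    (PerfectlyNormalSpace Y →
      LebesgueK1 X Y = LebesgueK1w X Y ∧ LebesgueK1w X Y ⊆ LebesgueH1 X Y) ∧
    (NormalSpace X → LebesgueH1 X Y ⊆ LebesgueK1w X Y) ∧
    (NormalSpace X →
      LebesgueH1 (HewittRealcompactification X) Y ⊆
        LebesgueK1w (HewittRealcompactification X) Y) := by
  have hKH : LebesgueK1 X Y ⊆ LebesgueH1 X Y := fun f hf V hV => (hf V hV).isFSigma
  have hKw : LebesgueK1 X Y ⊆ LebesgueK1w X Y := fun f hf V hV => hf V hV.isOpen
  refine ⟨hKw, fun _ => hKH.antisymm fun f hf V hV => ?_, fun _ => ?_,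
    fun _ => lebesgueH1_subset_lebesgueK1w,
    fun _ => HewittRealcompactification.lebesgueH1_subset_lebesgueK1w⟩
  · obtain ⟨F, hF, hFV⟩ := hf V hV
    exact ⟨F, fun n => (hF n).isFunctionallyClosed, hFV⟩
  · have hwK : LebesgueK1w X Y ⊆ LebesgueK1 X Y := fun f hf V hV =>
      hf V hV.isClosed_compl.isFunctionallyClosed
    exact ⟨hKw.antisymm hwK, hwK.trans hKH⟩
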